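/- Let $d\ge 1$ and let $V_1,V_2,\dots$ be i.i.d. random vectors in $\mathbb{R}^d$ (the coordinates of a single $V_t$ may be dependent). Put $R_n=V_1+\cdots+V_n$, with coordinates $R_{n,j}$, and $\mu_j=\mathbb{E}[V_{1,j}]$ for $j=1,\dots,d$. Assume that $0<\mu_1$ and $\mu_1<\mu_j$ for all $j\in\{2,\dots,d\}$ (the asymmetric case: the smallest drift is positive and is attained only by the first coordinate; no condition on the other drifts if $d=1$), and that for some real $q>2\sqrt{2}$ $$\mathbb{E}\bigl[|V_{1,j}-\mu_j|^q\bigr]<\infty\qquad\text{for all } j=1,\dots,d.$$ For $b\in\mathbb{R}$ let $$T_b=\inf\Bigl\{n\ge 1:\ \min_{1\le j\le d}R_{n,j}\ge b\Bigr\},\qquad \inf\emptyset=\infty.$$ Then $\mathbb{E}[T_b]<\infty$ for every $b\in\mathbb{R}$, and, as $b\to\infty$, $$\mathbb{E}[T_b]=\frac{b}{\mu_1}+O(1).$$ -/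

import Mathlib

open MeasureTheory ProbabilityTheory Filter Asymptotics
open scoped ENNReal

noncomputable section

namespace MultiRW

variable {Ω : Type*} [MeasurableSpace Ω] {d : ℕ}

/-- The random walk `R_n = V_1 + ⋯ + V_n`. Increments are indexed from zero: `V t` is the
`(t+1)`-st increment. -/
def walk (V : ℕ → Ω → Fin d → ℝ) (n : ℕ) (ω : Ω) : Fin d → ℝ :=
  ∑ t ∈ Finset.range n, V t ω

/-- The drift `μ_j = 𝔼[V_{1,j}]` of the `j`-th coordinate. -/
def drift (P : Measure Ω) (V : ℕ → Ω → Fin d → ℝ) (j : Fin d) : ℝ :=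
  ∫ ω, V 0 ω j ∂P

/-- `T_b = inf {n ≥ 1 : min_j R_{n,j} ≥ b}`, the first time at which every coordinate of the
random walk is at least `b`; it is `⊤` when there is no such time. -/
def firstTime (V : ℕ → Ω → Fin d → ℝ) (b : ℝ) (ω : Ω) : ℕ∞ :=
  ⨅ (n : ℕ) (_ : 1 ≤ n ∧ ∀ j, b ≤ walk V n ω j), (n : ℕ∞)

/-- The expectation of `T_b`, with values in `[0, ∞]`. -/
def expectedTime (P : Measure Ω) (V : ℕ → Ω → Fin d → ℝ) (b : ℝ) : ℝ≥0∞ :=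
  ∫⁻ ω, (firstTime V b ω : ℝ≥0∞) ∂P

end MultiRW

end

/-! Upper bound: let `y = b - R_n` be the vector of remaining distances. Foster's criterion needs a
nonnegative function `Φ` that loses at least `1` on average per step while some `y j > 0`, and that
equals `b / μ₁ + O(1)` on the diagonal. Take `Φ y = φ (y 0) + ∑ ψ_j (y j - y 0)`. The function `φ`
(`exists_lyapunov_le_div_add`) grows like `y / μ₁`, loses `1` while `y 0 ≥ 0`, and gains at most `B`
otherwise. The difference `y j - y 0` has negative drift by asymmetry, so there is a `ψ_j`
(`exists_lyapunov_of_neg_drift`) that never gains on average and loses `B + 1` on the half-line `0 ≤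
z`. If `y 0 < 0 < y i`, then `ψ_i` pays for `φ`. On the diagonal each `ψ_j` contributes only the
constant `ψ_j 0`.

Both functions have tails with exponent `-1/2`, hence slope corrections of order `x ^ (-3/2)`. Large
jumps then cost a multiple of `|h| ^ (5/2)` times that slope, so `5/2 < 2√2` moments suffice.

Lower bound (`le_expectedTime`): Wald's identity for the first coordinate, which is at least `b` at
time `T_b`. Truncation costs a constant, by a variance estimate. -/

namespace MultiRW

/-! ### One-variable functions and their one-step inequalities -/

/-- A convex `C¹` function with derivative `(1 + z⁻)^(-3/2)`. -/
noncomputable def convexLyapunov (z : ℝ) : ℝ := 2 / √(1 + max (-z) 0) + max z 0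

/-- The derivative of `convexLyapunov`. -/
noncomputable def convexLyapunovSlope (z : ℝ) : ℝ :=
  1 / ((1 + max (-z) 0) * √(1 + max (-z) 0))

/-- A function equal to `u + 2 - 2 / √(1 + u)` for `0 ≤ u`, and to `0` for `u ≤ 0`. -/
noncomputable def concaveLyapunov (u : ℝ) : ℝ := max u 0 + 2 - 2 / √(1 + max u 0)

lemma continuous_convexLyapunov : Continuous convexLyapunov := by
  unfold convexLyapunov
  refine Continuous.add (Continuous.div (by fun_prop) (by fun_prop) fun z => ?_) (by fun_prop)
  have : 0 ≤ max (-z) 0 := le_max_right _ _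
  positivity

lemma continuous_concaveLyapunov : Continuous concaveLyapunov := by
  unfold concaveLyapunov
  refine Continuous.sub (by fun_prop) (Continuous.div (by fun_prop) (by fun_prop) fun z => ?_)
  have : 0 ≤ max z 0 := le_max_right _ _
  positivity

lemma convexLyapunov_nonneg (z : ℝ) : 0 ≤ convexLyapunov z := by
  unfold convexLyapunov
  positivity

lemma one_le_sqrt_one_add {x : ℝ} (hx : 0 ≤ x) : 1 ≤ √(1 + x) :=
  Real.one_le_sqrt.2 (by linarith)

lemma two_div_sqrt_le_two {x : ℝ} (hx : 0 ≤ x) : 2 / √(1 + x) ≤ 2 :=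
  div_le_self (by norm_num) (one_le_sqrt_one_add hx)

lemma convexLyapunov_le (z : ℝ) : convexLyapunov z ≤ 2 + max z 0 := by
  unfold convexLyapunov
  linarith [two_div_sqrt_le_two (le_max_right (-z) 0)]

lemma concaveLyapunov_nonneg (u : ℝ) : 0 ≤ concaveLyapunov u := by
  unfold concaveLyapunov
  linarith [two_div_sqrt_le_two (le_max_right u 0), le_max_right u 0]

lemma concaveLyapunov_le (u : ℝ) : concaveLyapunov u ≤ max u 0 + 2 := by
  unfold concaveLyapunov
  have : 0 ≤ 2 / √(1 + max u 0) := by positivity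
  linarith

lemma convexLyapunovSlope_pos (z : ℝ) : 0 < convexLyapunovSlope z := by
  unfold convexLyapunovSlope
  have : 0 ≤ max (-z) 0 := le_max_right _ _
  positivity

lemma convexLyapunovSlope_of_nonneg {z : ℝ} (hz : 0 ≤ z) : convexLyapunovSlope z = 1 := by
  simp [convexLyapunovSlope, hz]

/-- Concavity of `-2 / √x`. -/
lemma two_div_sqrt_sub_le {x y : ℝ} (hx : 0 < x) (hy : 0 < y) :
    2 / √x - 2 / √y ≤ 1 / (x * √x) * (y - x) := by
  obtain ⟨s, hs, rfl⟩ : ∃ s, 0 < s ∧ s ^ 2 = x := ⟨√x, by positivity, Real.sq_sqrt hx.le⟩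
  obtain ⟨r, hr, rfl⟩ : ∃ r, 0 < r ∧ r ^ 2 = y := ⟨√y, by positivity, Real.sq_sqrt hy.le⟩
  rw [Real.sqrt_sq hs.le, Real.sqrt_sq hr.le]
  have : 1 / (s ^ 2 * s) * (r ^ 2 - s ^ 2) - (2 / s - 2 / r)
      = (r - s) ^ 2 * (r + 2 * s) / (s ^ 3 * r) := by
    field_simp
    ring
  have : 0 ≤ (r - s) ^ 2 * (r + 2 * s) / (s ^ 3 * r) := by positivity
  linarith

/-- `(1 - t)^(-1/2) ≤ 1 + t / 2 + t ^ 2` for `t ≤ 1 / 2`. -/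
lemma one_div_sqrt_one_sub_le {t : ℝ} (ht : t ≤ 1 / 2) :
    1 / √(1 - t) ≤ 1 + t / 2 + t ^ 2 := by
  have h1 : 0 < 1 - t := by linarith
  have hp : 0 < 1 + t / 2 + t ^ 2 := by nlinarith [sq_nonneg (t + 1 / 4)]
  rw [div_le_iff₀ (by positivity)]
  -- This is the cofactor in `(1 + t/2 + t²)² (1 - t) = 1 + t² (1.25 - 1.25 t - t³)`.
  have key : 0 ≤ 1.25 - 1.25 * t - t ^ 3 := by
    rcases le_total t 0 with h | h
    · nlinarith [pow_nonneg (neg_nonneg.2 h) 3]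
    · have : t ^ 3 ≤ (1 / 2) ^ 3 := by gcongr
      linarith
  have h2 : 1 ≤ (1 + t / 2 + t ^ 2) ^ 2 * (1 - t) := by
    have := mul_nonneg (sq_nonneg t) key
    nlinarith
  calc (1 : ℝ) = √1 := by simp
    _ ≤ √((1 + t / 2 + t ^ 2) ^ 2 * (1 - t)) := Real.sqrt_le_sqrt h2
    _ = _ := by rw [Real.sqrt_mul (sq_nonneg _), Real.sqrt_sq hp.le]

lemma two_div_sqrt_sub_le_quadratic {a h : ℝ} (ha : 1 ≤ a) (hh : h ≤ a / 2) :
    2 / √(a - h) ≤ 2 / √a + 1 / (a * √a) * (h + 2 * h ^ 2) := by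
  have ha0 : 0 < a := by linarith
  have h1 := one_div_sqrt_one_sub_le (t := h / a) (by rw [div_le_iff₀ ha0]; linarith)
  have h2 : √(a - h) = √a * √(1 - h / a) := by
    rw [← Real.sqrt_mul ha0.le]
    congr 1
    field_simp
  have h3 : 2 / √(a - h) = 2 / √a * (1 / √(1 - h / a)) := by
    rw [h2, div_mul_div_comm, mul_one]
  have h4 : h ^ 2 / a ≤ h ^ 2 := div_le_self (sq_nonneg h) ha
  calc 2 / √(a - h) ≤ 2 / √a * (1 + h / a / 2 + (h / a) ^ 2) := by
        rw [h3]
        gcongr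
    _ = 2 / √a + 1 / (a * √a) * (h + 2 * (h ^ 2 / a)) := by
        field_simp
        ring
    _ ≤ _ := by gcongr

/-- `convexLyapunov` is dominated by the extension of its left branch. -/
lemma convexLyapunov_le_two_div_sqrt {w : ℝ} (hw : w < 1) : convexLyapunov w ≤ 2 / √(1 - w) := by
  rcases le_total w 0 with h | h
  · simp [convexLyapunov, h, sub_eq_add_neg]
  · have := two_div_sqrt_sub_le (x := 1) (y := 1 - w) one_pos (by linarith)
    simp only [Real.sqrt_one] at this
    simp only [convexLyapunov, h, max_eq_left, Left.neg_nonpos_iff, max_eq_right, add_zero,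
      Real.sqrt_one]
    linarith

/-- The whole remainder carries the local slope as a factor, so after rescaling the drift dominates
it at every `z`. With `a = 1 - z` for `z < 0`, jumps up to `a / 2` are handled by a quadratic
expansion. Larger ones give a value at most `5 * h`, and `a ^ (3/2) ≤ 4 * h ^ (3/2)` turns this into
slope times `h ^ (5/2)`. -/
lemma convexLyapunov_add_le (z h : ℝ) :
    convexLyapunov (z + h) ≤ convexLyapunov z
      + convexLyapunovSlope z * (h + 20 * (h ^ 2 + h ^ 2 * √|h|)) := by
  have hr : 0 ≤ h ^ 2 * √|h| := by positivity
  rcases le_or_gt 0 z with hz | hz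
  · rw [convexLyapunovSlope_of_nonneg hz]
    have e : convexLyapunov z = 2 + z := by simp [convexLyapunov, hz]
    rw [e, one_mul]
    rcases le_or_gt 0 (z + h) with hw | hw
    · have e : convexLyapunov (z + h) = 2 + (z + h) := by simp only [convexLyapunov, max_eq_left hw, max_eq_right (neg_nonpos.2 hw)]; simp
      rw [e]
      nlinarith [sq_nonneg h]
    -- Expand at the kink `0` instead of at `z`; here `|z + h| ≤ |h|`.
    · have h1 := convexLyapunov_le_two_div_sqrt (w := z + h) (by linarith)
      have h2 := two_div_sqrt_sub_le_quadratic (a := 1) (h := z + h) le_rfl (by linarith)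
      simp only [Real.sqrt_one] at h2
      nlinarith [sq_nonneg h]
  · set a := 1 - z with ha
    have ha1 : 1 ≤ a := by linarith
    have e : convexLyapunov z = 2 / √a := by
      simp [convexLyapunov, hz.le, ha, sub_eq_add_neg]
    have e' : convexLyapunovSlope z = 1 / (a * √a) := by
      simp [convexLyapunovSlope, hz.le, ha, sub_eq_add_neg]
    rw [e, e']
    rcases le_or_gt h (a / 2) with hh | hh
    · have h1 := convexLyapunov_le_two_div_sqrt (w := z + h) (by linarith)
      have h2 := two_div_sqrt_sub_le_quadratic ha1 hh
      have h3 : 1 - (z + h) = a - h := by rw [ha]; ring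
      rw [h3] at h1
      refine (h1.trans h2).trans ?_
      have h4 : h + 2 * h ^ 2 ≤ h + 20 * (h ^ 2 + h ^ 2 * √|h|) := by nlinarith [sq_nonneg h]
      gcongr
    · have h0 : 0 < h := by linarith
      have h1 := convexLyapunov_le (z + h)
      have h2 : max (z + h) 0 ≤ h := max_le (by linarith) h0.le
      have h3 : 2 + h ≤ 5 * h := by linarith
      have h4 : a * √a ≤ 4 * (h * √h) := by
        have : a * √a ≤ (4 * h) * √h * 1 := by
          have h5 : √a ≤ √(4 * h) := Real.sqrt_le_sqrt (by linarith)
          have h6 : √(4 * h) = 2 * √h := by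
            rw [Real.sqrt_mul (by norm_num), show (4 : ℝ) = 2 ^ 2 by norm_num,
              Real.sqrt_sq (by norm_num)]
          calc a * √a ≤ (2 * h) * (2 * √h) := by
                rw [← h6]
                gcongr
                linarith
            _ = _ := by ring
        linarith
      have h5 : 5 * h ≤ 1 / (a * √a) * (20 * (h ^ 2 * √h)) := by
        rw [div_mul_eq_mul_div, le_div_iff₀ (by positivity)]
        nlinarith
      have h6 : 1 / (a * √a) * (20 * (h ^ 2 * √h))
          ≤ 1 / (a * √a) * (h + 20 * (h ^ 2 + h ^ 2 * √|h|)) := by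
        rw [abs_of_pos h0]
        gcongr
        nlinarith [sq_nonneg h]
      have : 0 ≤ 2 / √a := by positivity
      linarith

/-- Concavity gives the tangent bound as long as `u + h ≥ 0`. A jump below `0` has `|h| > u ≥ 1`, so
`1 + u ≤ 2 * |h|` and the `|h| ^ (5/2)` term absorbs the truncation. -/
lemma concaveLyapunov_add_le {u : ℝ} (hu : 1 ≤ u) (h : ℝ) :
    concaveLyapunov (u + h) ≤ concaveLyapunov u
      + (h + 1 / ((1 + u) * √(1 + u)) * (h + 8 * (h ^ 2 * √|h|))) := by
  have hr : 0 ≤ h ^ 2 * √|h| := by positivity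
  have hu0 : 0 ≤ u := by linarith
  have hk : 0 < 1 / ((1 + u) * √(1 + u)) := by positivity
  rcases le_or_gt 0 (u + h) with hw | hw
  · have h1 := two_div_sqrt_sub_le (x := 1 + u) (y := 1 + (u + h)) (by linarith) (by linarith)
    have h2 : 1 + (u + h) - (1 + u) = h := by ring
    rw [h2] at h1
    simp only [concaveLyapunov, max_eq_left hw, max_eq_left hu0]
    nlinarith
  · have e : concaveLyapunov (u + h) = 0 := by simp [concaveLyapunov, hw.le]
    have h1 := concaveLyapunov_nonneg u
    have hk1 : 1 / ((1 + u) * √(1 + u)) ≤ 1 := by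
      rw [div_le_one (by positivity)]
      nlinarith [one_le_sqrt_one_add hu0]
    obtain ⟨k, rfl⟩ : ∃ k, h = -k := ⟨-h, by ring⟩
    have hk0 : 0 < k := by linarith
    rw [e, abs_neg, abs_of_pos hk0]
    have h4 : (1 + u) * √(1 + u) ≤ 4 * (k * √k) := by
      have h5 : √(1 + u) ≤ √(4 * k) := Real.sqrt_le_sqrt (by linarith)
      have h6 : √(4 * k) = 2 * √k := by
        rw [Real.sqrt_mul (by norm_num), show (4 : ℝ) = 2 ^ 2 by norm_num,
          Real.sqrt_sq (by norm_num)]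
      calc (1 + u) * √(1 + u) ≤ (2 * k) * (2 * √k) := by
            rw [← h6]
            gcongr
            linarith
        _ = _ := by ring
    have h5 : 2 * k ≤ 1 / ((1 + u) * √(1 + u)) * (8 * (k ^ 2 * √k)) := by
      rw [div_mul_eq_mul_div, le_div_iff₀ (by positivity)]
      nlinarith
    rw [neg_sq]
    nlinarith

lemma concaveLyapunov_mono : Monotone concaveLyapunov := by
  intro u v huv
  unfold concaveLyapunov
  have : 0 ≤ max u 0 := le_max_right _ _
  gcongr

/-- The slope is at most `2`. This crude bound limits the gain of `φ` where the first coordinate is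
already past its level. -/
lemma concaveLyapunov_add_le_abs (u h : ℝ) :
    concaveLyapunov (u + h) ≤ concaveLyapunov u + 2 * |h| := by
  have h0 : 0 ≤ max u 0 := le_max_right _ _
  have h1 : concaveLyapunov (u + h) ≤ concaveLyapunov (max u 0 + |h|) :=
    concaveLyapunov_mono (add_le_add (le_max_left _ _) (le_abs_self h))
  have h2 : concaveLyapunov (max u 0) = concaveLyapunov u := by simp [concaveLyapunov]
  have h3 := two_div_sqrt_sub_le (x := 1 + max u 0) (y := 1 + (max u 0 + |h|)) (by positivity)
    (by positivity)
  have e : 1 + (max u 0 + |h|) - (1 + max u 0) = |h| := by ring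
  rw [e] at h3
  have hk1 : 1 / ((1 + max u 0) * √(1 + max u 0)) ≤ 1 := by
    rw [div_le_one (by positivity)]
    nlinarith [one_le_sqrt_one_add h0]
  have h4 : concaveLyapunov (max u 0 + |h|) ≤ concaveLyapunov (max u 0) + 2 * |h| := by
    have : 0 ≤ max u 0 + |h| := by positivity
    simp only [concaveLyapunov, max_eq_left this, max_eq_left h0]
    nlinarith [abs_nonneg h]
  linarith

/-! ### Lyapunov functions for one-dimensional steps -/

lemma sq_mul_sqrt_abs_mul_le {ε : ℝ} (hε : 0 < ε) (hε1 : ε ≤ 1) (x : ℝ) :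
    (ε * x) ^ 2 * √|ε * x| ≤ ε ^ 2 * (x ^ 2 * √|x|) := by
  have h : √|ε * x| ≤ √|x| := by
    refine Real.sqrt_le_sqrt ?_
    rw [abs_mul, abs_of_pos hε]
    exact mul_le_of_le_one_left (abs_nonneg x) hε1
  calc (ε * x) ^ 2 * √|ε * x| ≤ (ε * x) ^ 2 * √|x| := by gcongr
    _ = _ := by ring

/-- For a step with negative mean there is a nonnegative Lyapunov function on the line whose
expected one-step change is nonpositive everywhere and at most `-D` on the half-line `0 ≤ z`. -/
lemma exists_lyapunov_of_neg_drift {Ω : Type*} [MeasurableSpace Ω] {P : Measure Ω}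
    [IsProbabilityMeasure P] {ξ : Ω → ℝ} (h1 : Integrable ξ P)
    (h2 : Integrable (fun ω => ξ ω ^ 2) P) (h3 : Integrable (fun ω => ξ ω ^ 2 * √|ξ ω|) P)
    (hneg : ∫ ω, ξ ω ∂P < 0) {D : ℝ} (hD : 0 ≤ D) :
    ∃ ψ : ℝ → ℝ, Measurable ψ ∧ (∀ z, 0 ≤ ψ z) ∧ (∀ z, Integrable (fun ω => ψ (z + ξ ω)) P) ∧
      (∀ z, ∫ ω, ψ (z + ξ ω) ∂P ≤ ψ z) ∧ ∀ z, 0 ≤ z → ∫ ω, ψ (z + ξ ω) ∂P ≤ ψ z - D := by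
  obtain ⟨ν, hν⟩ : ∃ ν, ν = -∫ ω, ξ ω ∂P := ⟨_, rfl⟩
  have hν0 : 0 < ν := by linarith
  obtain ⟨M, hM⟩ : ∃ M, M = ∫ ω, (ξ ω ^ 2 + ξ ω ^ 2 * √|ξ ω|) ∂P := ⟨_, rfl⟩
  have hM0 : 0 ≤ M := hM ▸ integral_nonneg fun ω => by positivity
  -- Rescaling by `ε` makes the drift of order `ε` and the error of order `ε ^ 2`; the error `20 * ε
  -- ^ 2 * M` then uses at most half of `ε * ν`.
  obtain ⟨ε, hε0, hε1, hεM⟩ : ∃ ε : ℝ, 0 < ε ∧ ε ≤ 1 ∧ 40 * (ε * M) ≤ ν := by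
    refine ⟨min 1 (ν / (40 * (M + 1))), lt_min one_pos (by positivity), min_le_left _ _, ?_⟩
    have : min 1 (ν / (40 * (M + 1))) * (40 * (M + 1)) ≤ ν := by
      rw [← le_div_iff₀ (by positivity)]
      exact min_le_right _ _
    have : 0 ≤ min 1 (ν / (40 * (M + 1))) := le_min zero_le_one (by positivity)
    nlinarith
  have hF : Continuous fun z => convexLyapunov (ε * z) :=
    continuous_convexLyapunov.comp (by fun_prop)
  have hint : ∀ z, Integrable (fun ω => convexLyapunov (ε * (z + ξ ω))) P := fun z => by
    refine Integrable.mono' (g := fun ω => 2 + |ε * (z + ξ ω)|) (by fun_prop)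
      (hF.comp_aestronglyMeasurable (by fun_prop)) (ae_of_all _ fun ω => ?_)
    rw [Real.norm_of_nonneg (convexLyapunov_nonneg _)]
    have := convexLyapunov_le (ε * (z + ξ ω))
    have : max (ε * (z + ξ ω)) 0 ≤ |ε * (z + ξ ω)| := max_le (le_abs_self _) (abs_nonneg _)
    linarith
  have hdrift : ∀ z, ∫ ω, convexLyapunov (ε * (z + ξ ω)) ∂P
      ≤ convexLyapunov (ε * z) - convexLyapunovSlope (ε * z) * (ε * ν / 2) := fun z => by
    have hb : ∀ ω, convexLyapunov (ε * (z + ξ ω)) ≤ convexLyapunov (ε * z)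
        + convexLyapunovSlope (ε * z)
          * (ε * ξ ω + 20 * ε ^ 2 * (ξ ω ^ 2 + ξ ω ^ 2 * √|ξ ω|)) := fun ω => by
      rw [mul_add ε]
      refine (convexLyapunov_add_le _ _).trans ?_
      have := sq_mul_sqrt_abs_mul_le hε0 hε1 (ξ ω)
      refine add_le_add_right (mul_le_mul_of_nonneg_left ?_ (convexLyapunovSlope_pos _).le) _
      linarith
    have hi : Integrable (fun ω => ξ ω ^ 2 + ξ ω ^ 2 * √|ξ ω|) P := h2.add h3
    have hi' : Integrable (fun ω => ε * ξ ω + 20 * ε ^ 2 * (ξ ω ^ 2 + ξ ω ^ 2 * √|ξ ω|)) P :=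
      (h1.const_mul _).add (hi.const_mul _)
    refine (integral_mono (hint z) ((integrable_const _).add (hi'.const_mul _)) hb).trans ?_
    rw [integral_add' (integrable_const _) (hi'.const_mul _), integral_const_mul,
      integral_add (h1.const_mul _) (hi.const_mul _), integral_const_mul, integral_const_mul,
      ← hM, integral_const, probReal_univ, one_smul]
    have := convexLyapunovSlope_pos (ε * z)
    have h4 : ε * ∫ ω, ξ ω ∂P = -(ε * ν) := by rw [hν]; ring
    have h5 : ε * (40 * (ε * M)) ≤ ε * ν := by gcongr
    rw [h4, sub_eq_add_neg, ← mul_neg (convexLyapunovSlope _)]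
    refine add_le_add_right (mul_le_mul_of_nonneg_left ?_ this.le) _
    linarith
  have hc : 0 ≤ 2 * D / (ε * ν) := by positivity
  refine ⟨fun z => 2 * D / (ε * ν) * convexLyapunov (ε * z), hF.measurable.const_mul _,
    fun z => mul_nonneg hc (convexLyapunov_nonneg _), fun z => (hint z).const_mul _,
    fun z => ?_, fun z hz => ?_⟩
  · rw [integral_const_mul]
    have h6 := hdrift z
    have : 0 ≤ convexLyapunovSlope (ε * z) * (ε * ν / 2) :=
      mul_nonneg (convexLyapunovSlope_pos _).le (by positivity)
    exact mul_le_mul_of_nonneg_left (by linarith) hc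
  · rw [integral_const_mul]
    have h6 := hdrift z
    rw [convexLyapunovSlope_of_nonneg (by positivity), one_mul] at h6
    refine (mul_le_mul_of_nonneg_left h6 hc).trans (le_of_eq ?_)
    field_simp

/-- For a step `-X` with `𝔼 X = μ > 0` there is a nonnegative Lyapunov function on the line, within
a constant of `y / μ` for `0 ≤ y`, whose expected one-step change is bounded above, and at most
`-1` on the half-line `0 ≤ y`. -/
lemma exists_lyapunov_le_div_add {Ω : Type*} [MeasurableSpace Ω] {P : Measure Ω}
    [IsProbabilityMeasure P] {ξ : Ω → ℝ} {μ : ℝ} (h1 : Integrable ξ P)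
    (h3 : Integrable (fun ω => ξ ω ^ 2 * √|ξ ω|) P) (hξ : ∫ ω, ξ ω ∂P = -μ) (hμ : 0 < μ) :
    ∃ φ : ℝ → ℝ, Measurable φ ∧ (∀ y, 0 ≤ φ y) ∧ (∀ y, Integrable (fun ω => φ (y + ξ ω)) P) ∧
      (∃ B, 0 ≤ B ∧ ∀ y, ∫ ω, φ (y + ξ ω) ∂P ≤ φ y + B) ∧
      (∀ y, 0 ≤ y → ∫ ω, φ (y + ξ ω) ∂P ≤ φ y - 1) ∧
      ∃ C, ∀ y, 0 ≤ y → φ y ≤ y / μ + C := by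
  obtain ⟨M, hM⟩ : ∃ M, M = ∫ ω, ξ ω ^ 2 * √|ξ ω| ∂P := ⟨_, rfl⟩
  have hM0 : 0 ≤ M := hM ▸ integral_nonneg fun ω => by positivity
  -- The error is paid by the excess slope `k` alone, leaving the main drift `-ε * μ` intact; hence
  -- the exact coefficient `1 / μ`.
  obtain ⟨ε, hε0, hε1, hεM⟩ : ∃ ε : ℝ, 0 < ε ∧ ε ≤ 1 ∧ 8 * (ε * M) ≤ μ := by
    refine ⟨min 1 (μ / (8 * (M + 1))), lt_min one_pos (by positivity), min_le_left _ _, ?_⟩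
    have : min 1 (μ / (8 * (M + 1))) * (8 * (M + 1)) ≤ μ := by
      rw [← le_div_iff₀ (by positivity)]
      exact min_le_right _ _
    have : 0 ≤ min 1 (μ / (8 * (M + 1))) := le_min zero_le_one (by positivity)
    nlinarith
  have hG : Continuous fun y => concaveLyapunov (1 + ε * y) :=
    continuous_concaveLyapunov.comp (by fun_prop)
  have hint : ∀ y, Integrable (fun ω => concaveLyapunov (1 + ε * (y + ξ ω))) P := fun y => by
    refine Integrable.mono' (g := fun ω => |1 + ε * (y + ξ ω)| + 2) (by fun_prop)
      (hG.comp_aestronglyMeasurable (by fun_prop)) (ae_of_all _ fun ω => ?_)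
    rw [Real.norm_of_nonneg (concaveLyapunov_nonneg _)]
    refine (concaveLyapunov_le _).trans ?_
    gcongr
    exact max_le (le_abs_self _) (abs_nonneg _)
  have hc : 0 ≤ 1 / (ε * μ) := by positivity
  -- The shift by `1` ensures `u ≥ 1` whenever `y ≥ 0`.
  refine ⟨fun y => 1 / (ε * μ) * concaveLyapunov (1 + ε * y), hG.measurable.const_mul _,
    fun y => mul_nonneg hc (concaveLyapunov_nonneg _), fun y => (hint y).const_mul _,
    ⟨1 / (ε * μ) * (2 * ∫ ω, |ε * ξ ω| ∂P), ?_, fun y => ?_⟩, fun y hy => ?_,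
    3 / (ε * μ), fun y hy => ?_⟩
  · have : 0 ≤ ∫ ω, |ε * ξ ω| ∂P := integral_nonneg fun ω => abs_nonneg _
    positivity
  · have hi : Integrable (fun ω => 2 * |ε * ξ ω|) P := (h1.const_mul ε).abs.const_mul 2
    rw [integral_const_mul, ← mul_add]
    refine mul_le_mul_of_nonneg_left ?_ hc
    refine (integral_mono (hint y) ((integrable_const (concaveLyapunov (1 + ε * y))).add hi)
      fun ω => ?_).trans ?_
    · have := concaveLyapunov_add_le_abs (1 + ε * y) (ε * ξ ω)
      rwa [add_assoc, ← mul_add] at this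
    · rw [integral_add' (integrable_const _) hi, integral_const_mul, integral_const,
        probReal_univ, one_smul]
  · set u := 1 + ε * y with hu
    have hu1 : 1 ≤ u := by nlinarith
    set k := 1 / ((1 + u) * √(1 + u)) with hk
    have hk0 : 0 ≤ k := by positivity
    have hb : ∀ ω, concaveLyapunov (1 + ε * (y + ξ ω)) ≤ concaveLyapunov u
        + (ε * ξ ω + k * (ε * ξ ω + 8 * ε ^ 2 * (ξ ω ^ 2 * √|ξ ω|))) := fun ω => by
      have h4 := concaveLyapunov_add_le hu1 (ε * ξ ω)
      rw [mul_add ε, ← add_assoc, ← hu]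
      refine h4.trans ?_
      have := sq_mul_sqrt_abs_mul_le hε0 hε1 (ξ ω)
      refine add_le_add_right (add_le_add_right (mul_le_mul_of_nonneg_left ?_ hk0) _) _
      linarith
    have hi : Integrable (fun ω => ε * ξ ω + 8 * ε ^ 2 * (ξ ω ^ 2 * √|ξ ω|)) P :=
      (h1.const_mul _).add (h3.const_mul _)
    have hi' : Integrable
        (fun ω => ε * ξ ω + k * (ε * ξ ω + 8 * ε ^ 2 * (ξ ω ^ 2 * √|ξ ω|))) P :=
      (h1.const_mul _).add (hi.const_mul _)
    have hd : ∫ ω, concaveLyapunov (1 + ε * (y + ξ ω)) ∂P ≤ concaveLyapunov u - ε * μ := by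
      refine (integral_mono (hint y) ((integrable_const _).add hi') hb).trans ?_
      rw [integral_add' (integrable_const _) hi', integral_add (h1.const_mul _) (hi.const_mul _),
        integral_const_mul, integral_const_mul, integral_add (h1.const_mul _) (h3.const_mul _),
        integral_const_mul, integral_const_mul, ← hM, hξ, integral_const, probReal_univ, one_smul]
      have h5 : ε * (8 * (ε * M)) ≤ ε * μ := by gcongr
      have h6 : k * (ε * -μ + 8 * ε ^ 2 * M) ≤ 0 :=
        mul_nonpos_of_nonneg_of_nonpos hk0 (by linarith)
      linarith
    rw [integral_const_mul]
    refine (mul_le_mul_of_nonneg_left hd hc).trans (le_of_eq ?_)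
    change _ = 1 / (ε * μ) * concaveLyapunov u - 1
    field_simp
  · have h4 : 0 ≤ 1 + ε * y := by positivity
    have h5 := concaveLyapunov_le (1 + ε * y)
    rw [max_eq_left h4] at h5
    refine (mul_le_mul_of_nonneg_left h5 hc).trans (le_of_eq ?_)
    field_simp
    ring

/-! ### The event `T_b > k` and independence from the past -/

/-- The event that the walk has not reached level `b` in all coordinates by time `k`. -/
def notReached {Ω : Type*} {d : ℕ} (V : ℕ → Ω → Fin d → ℝ) (b : ℝ) (k : ℕ) : Set Ω :=
  {ω | ∀ m, 1 ≤ m → m ≤ k → ∃ j, walk V m ω j < b}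

/-- The `σ`-algebra generated by the first `k` increments. -/
@[reducible] def past {Ω : Type*} {d : ℕ} (V : ℕ → Ω → Fin d → ℝ) (k : ℕ) : MeasurableSpace Ω :=
  ⨆ i ∈ Set.Iio k, MeasurableSpace.comap (V i) inferInstance

section Pathwise

variable {Ω : Type*} {d : ℕ} {V : ℕ → Ω → Fin d → ℝ} {b : ℝ}

lemma walk_succ (V : ℕ → Ω → Fin d → ℝ) (n : ℕ) (ω : Ω) :
    walk V (n + 1) ω = walk V n ω + V n ω := by
  simp [walk, Finset.sum_range_succ]

lemma walk_apply (V : ℕ → Ω → Fin d → ℝ) (n : ℕ) (ω : Ω) (j : Fin d) :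
    walk V n ω j = ∑ t ∈ Finset.range n, V t ω j := by
  simp [walk]

lemma notReached_antitone (V : ℕ → Ω → Fin d → ℝ) (b : ℝ) : Antitone (notReached V b) :=
  fun _ _ hkl _ hω m hm hmk => hω m hm (hmk.trans hkl)

lemma lt_firstTime_iff {k : ℕ} {ω : Ω} :
    (k : ℕ∞) < firstTime V b ω ↔ ω ∈ notReached V b k := by
  rw [← not_iff_not, not_lt, firstTime, ← ENat.lt_natCast_add_one_iff]
  simp only [iInf_lt_iff, notReached, Set.mem_ofPred_eq]
  push Not
  constructor
  · rintro ⟨n, ⟨h1, h2⟩, h3⟩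
    exact ⟨n, h1, Nat.lt_succ_iff.1 (by exact_mod_cast h3), h2⟩
  · rintro ⟨n, h1, h3, h2⟩
    exact ⟨n, ⟨h1, h2⟩, by exact_mod_cast Nat.lt_succ_iff.2 h3⟩

lemma firstTime_mono (V : ℕ → Ω → Fin d → ℝ) {b c : ℝ} (h : b ≤ c) (ω : Ω) :
    firstTime V b ω ≤ firstTime V c ω :=
  le_iInf₂ fun n hn => iInf₂_le n ⟨hn.1, fun j => h.trans (hn.2 j)⟩

lemma toENNReal_eq_tsum (n : ℕ∞) :
    (n : ℝ≥0∞) = ∑' k : ℕ, {k : ℕ | (k : ℕ∞) < n}.indicator 1 k := by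
  induction n with
  | top => simp
  | coe n =>
    rw [tsum_eq_sum (s := Finset.range n) fun k hk => by simpa using hk,
      Finset.sum_congr rfl (g := fun _ => 1) fun k hk => by
        simp [Finset.mem_range.1 hk]]
    simp

/-- The increments up to the time when level `b` is reached sum to at least `b`. -/
lemma le_sum_indicator_of_notMem [NeZero d] {n : ℕ} {ω : Ω} (h : ω ∉ notReached V b n) :
    b ≤ ∑ k ∈ Finset.range n, (notReached V b k).indicator (fun ω => V k ω 0) ω := by
  induction n with
  | zero => exact absurd (fun m h1 h2 => by omega) h
  | succ n ih =>
    by_cases hn : ω ∈ notReached V b n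
    · have hs : ∑ k ∈ Finset.range (n + 1), (notReached V b k).indicator (fun ω => V k ω 0) ω
          = walk V (n + 1) ω 0 := by
        rw [walk_apply]
        refine Finset.sum_congr rfl fun k hk => Set.indicator_of_mem
          (notReached_antitone V b (Nat.lt_succ_iff.1 (Finset.mem_range.1 hk)) hn) _
      rw [hs]
      simp only [notReached, Set.mem_ofPred_eq] at h hn
      push Not at h
      obtain ⟨m, h1, h2, h3⟩ := h
      rcases Nat.lt_or_ge n m with hm | hm
      · obtain rfl : m = n + 1 := by omega
        exact h3 0
      · obtain ⟨j, hj⟩ := hn m h1 hm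
        exact absurd (h3 j) (not_le.2 hj)
    · rw [Finset.sum_range_succ, Set.indicator_of_notMem hn, add_zero]
      exact ih hn

lemma measurable_past_walk {m k : ℕ} (h : m ≤ k) : Measurable[past V k] (walk V m) := by
  have e : walk V m = fun ω => ∑ t ∈ Finset.range m, V t ω := rfl
  rw [e]
  refine Finset.measurable_sum (m := past V k) _ fun i hi => ?_
  refine Measurable.mono (comap_measurable (V i)) ?_ le_rfl
  exact le_iSup₂_of_le i ((Finset.mem_range.1 hi).trans_le h) le_rfl

lemma measurableSet_past_notReached (V : ℕ → Ω → Fin d → ℝ) (b : ℝ) (k : ℕ) :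
    MeasurableSet[past V k] (notReached V b k) := by
  have : notReached V b k
      = ⋂ m, ⋂ (_ : 1 ≤ m), ⋂ (_ : m ≤ k), ⋃ j, {ω | walk V m ω j < b} := by
    ext ω
    simp [notReached]
  rw [this]
  refine MeasurableSet.iInter fun m => MeasurableSet.iInter fun _ =>
    MeasurableSet.iInter fun h => MeasurableSet.iUnion fun j => ?_
  let := past V k
  exact measurableSet_lt ((measurable_pi_apply j).comp (measurable_past_walk h)) measurable_const

lemma measurable_past_indicator (V : ℕ → Ω → Fin d → ℝ) (b : ℝ) (k : ℕ) :
    Measurable[past V k] ((notReached V b k).indicator (1 : Ω → ℝ)) := by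
  let := past V k
  exact measurable_one.indicator (measurableSet_past_notReached V b k)

end Pathwise

lemma measurable_prodMk_indicator {Ω E : Type*} {m : MeasurableSpace Ω} [MeasurableSpace E]
    {Z : Ω → E} {s : Set Ω} (hZ : Measurable Z) (hs : MeasurableSet s) :
    Measurable fun ω => (Z ω, s.indicator (1 : Ω → ℝ≥0∞) ω) :=
  hZ.prodMk (measurable_one.indicator hs)

/-- Integrating out a variable that is independent of the past. -/
lemma setLIntegral_of_indep {Ω E F : Type*} [MeasurableSpace E] [MeasurableSpace F]
    {m mΩ : MeasurableSpace Ω} {P : Measure Ω} [IsProbabilityMeasure P] (hm : m ≤ mΩ) {Z : Ω → E} {Y : Ω → F} {s : Set Ω}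
    (hZ : Measurable[m] Z) (hs : MeasurableSet[m] s) (hY : Measurable Y)
    (hind : Indep m (MeasurableSpace.comap Y inferInstance) P) {f : E × F → ℝ≥0∞}
    (hf : Measurable f) :
    ∫⁻ ω in s, f (Z ω, Y ω) ∂P = ∫⁻ ω in s, ∫⁻ y, f (Z ω, y) ∂(P.map Y) ∂P := by
  -- Pairing `Z` with the indicator of `s` puts both under one joint law with `Y`, so the product
  -- formula handles the restriction to `s`.
  have hX : Measurable[m] fun ω => (Z ω, s.indicator (1 : Ω → ℝ≥0∞) ω) :=
    measurable_prodMk_indicator hZ hs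
  have hX' : Measurable fun ω => (Z ω, s.indicator (1 : Ω → ℝ≥0∞) ω) := hX.mono hm le_rfl
  have hI : IndepFun (fun ω => (Z ω, s.indicator (1 : Ω → ℝ≥0∞) ω)) Y P :=
    indep_of_indep_of_le_left hind hX.comap_le
  have hg : Measurable fun p : (E × ℝ≥0∞) × F => p.1.2 * f (p.1.1, p.2) := by fun_prop
  have := Measure.isProbabilityMeasure_map (μ := P) hY.aemeasurable
  have hl : ∀ g : Ω → ℝ≥0∞, ∫⁻ ω in s, g ω ∂P = ∫⁻ ω, s.indicator 1 ω * g ω ∂P := fun g => by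
    rw [← lintegral_indicator (hm _ hs)]
    refine lintegral_congr fun ω => ?_
    by_cases h : ω ∈ s <;> simp [h]
  have h1 := lintegral_map (μ := P) hg (hX'.prodMk hY)
  rw [hI.map_prod_eq_prod_map_map hX'.aemeasurable hY.aemeasurable,
    lintegral_prod _ hg.aemeasurable, lintegral_map hg.lintegral_prod_right' hX'] at h1
  rw [hl, hl, ← h1]
  refine lintegral_congr fun ω => ?_
  exact lintegral_const_mul _ (hf.comp measurable_prodMk_left)

section Independence

variable {Ω : Type*} [mΩ : MeasurableSpace Ω] {P : Measure Ω} {d : ℕ}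
  {V : ℕ → Ω → Fin d → ℝ}

lemma past_le (hmeas : ∀ t, Measurable (V t)) (k : ℕ) : past V k ≤ mΩ :=
  iSup₂_le fun i _ => (hmeas i).comap_le

lemma measurableSet_notReached (hmeas : ∀ t, Measurable (V t)) (b : ℝ) (k : ℕ) :
    MeasurableSet (notReached V b k) :=
  past_le hmeas k _ (measurableSet_past_notReached V b k)

lemma indep_past (hmeas : ∀ t, Measurable (V t)) (hindep : iIndepFun V P) (k : ℕ) :
    Indep (past V k) (MeasurableSpace.comap (V k) inferInstance) P := by
  have := indep_iSup_of_disjoint (fun i => (hmeas i).comap_le) hindep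
    (S := Set.Iio k) (T := {k}) (by simp)
  simpa [past] using this

lemma lintegral_firstTime (hmeas : ∀ t, Measurable (V t)) (b : ℝ) :
    expectedTime P V b = ∑' k, P (notReached V b k) := by
  unfold expectedTime
  have : ∀ ω, (firstTime V b ω : ℝ≥0∞) = ∑' k, (notReached V b k).indicator 1 ω := fun ω => by
    rw [toENNReal_eq_tsum]
    refine tsum_congr fun k => ?_
    by_cases h : ω ∈ notReached V b k
    · simp [h, lt_firstTime_iff]
    · simp [h, lt_firstTime_iff]
  simp_rw [this]
  rw [lintegral_tsum fun k =>
    (measurable_one.indicator (measurableSet_notReached hmeas b k)).aemeasurable]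
  exact tsum_congr fun k => lintegral_indicator_one (measurableSet_notReached hmeas b k)

/-- The event `T_b > k` is decided by `V 0, …, V (k - 1)`; this is the independence behind Wald's
identity. -/
lemma indepFun_indicator_notReached (hmeas : ∀ t, Measurable (V t)) (hindep : iIndepFun V P)
    (b : ℝ) (k : ℕ) (j : Fin d) :
    IndepFun ((notReached V b k).indicator (1 : Ω → ℝ)) (fun ω => V k ω j) P := by
  have h1 := measurable_past_indicator V b k
  have h2 : IndepFun ((notReached V b k).indicator (1 : Ω → ℝ)) (V k) P :=
    indep_of_indep_of_le_left (indep_past hmeas hindep k) h1.comap_le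
  exact h2.comp measurable_id (measurable_pi_apply j)

variable [IsProbabilityMeasure P]

/-! ### Upper bound: Foster's criterion -/

/-- Foster's criterion: a nonnegative function of the remaining distance that decreases by at
least `1` on average before level `b` is reached bounds the expected time to reach it. -/
lemma expectedTime_le_of_drift [NeZero d] (hmeas : ∀ t, Measurable (V t))
    (hindep : iIndepFun V P) (hident : ∀ t, IdentDistrib (V t) (V 0) P P)
    {Φ : (Fin d → ℝ) → ℝ} (hΦ : Measurable Φ) (hΦ0 : ∀ y, 0 ≤ Φ y)
    (hint : ∀ y, Integrable (fun ω => Φ (y - V 0 ω)) P)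
    (hdrift : ∀ y, (∃ j, 0 < y j) → ∫ ω, Φ (y - V 0 ω) ∂P ≤ Φ y - 1) {b : ℝ} (hb : 0 < b) :
    expectedTime P V b ≤ ENNReal.ofReal (Φ fun _ => b) := by
  have hstep : ∀ k, ∫⁻ ω in notReached V b (k + 1),
        ENNReal.ofReal (Φ ((fun _ => b) - walk V (k + 1) ω)) ∂P + P (notReached V b k)
      ≤ ∫⁻ ω in notReached V b k, ENNReal.ofReal (Φ ((fun _ => b) - walk V k ω)) ∂P := fun k => by
    have hf : Measurable fun p : (Fin d → ℝ) × (Fin d → ℝ) =>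
        ENNReal.ofReal (Φ ((fun _ => b) - p.1 - p.2)) := by fun_prop
    have hlaw : P.map (V k) = P.map (V 0) := (hident k).map_eq
    calc _ ≤ ∫⁻ ω in notReached V b k,
          ENNReal.ofReal (Φ ((fun _ => b) - walk V (k + 1) ω)) ∂P + P (notReached V b k) := by
          gcongr
          exact notReached_antitone V b k.le_succ
      _ = ∫⁻ ω in notReached V b k,
          ∫⁻ ω', ENNReal.ofReal (Φ ((fun _ => b) - walk V k ω - V 0 ω')) ∂P ∂P
            + ∫⁻ ω in notReached V b k, 1 ∂P := by
          simp_rw [walk_succ, ← sub_sub]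
          rw [setLIntegral_of_indep (past_le hmeas k) (measurable_past_walk le_rfl)
            (measurableSet_past_notReached V b k) (hmeas k) (indep_past hmeas hindep k) hf, hlaw]
          congr 1
          · refine lintegral_congr fun ω => ?_
            exact lintegral_map (hf.comp measurable_prodMk_left) (hmeas 0)
          · simp
      _ = ∫⁻ ω in notReached V b k,
          (∫⁻ ω', ENNReal.ofReal (Φ ((fun _ => b) - walk V k ω - V 0 ω')) ∂P + 1) ∂P :=
          (lintegral_add_right _ measurable_const).symm
      _ ≤ _ := by
          refine setLIntegral_mono' (measurableSet_notReached hmeas b k) fun ω hω => ?_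
          have hpos : ∃ j, 0 < ((fun _ => b) - walk V k ω : Fin d → ℝ) j := by
            -- At time `0` the event is the whole space and says nothing about the walk; positivity
            -- comes from `0 < b`.
            rcases Nat.eq_zero_or_pos k with rfl | hk
            · exact ⟨0, by simpa [walk] using hb⟩
            · obtain ⟨j, hj⟩ := hω k hk le_rfl
              exact ⟨j, by simpa using hj⟩
          have h1 := hdrift _ hpos
          rw [← ofReal_integral_eq_lintegral_ofReal (hint _) (ae_of_all _ fun _ => hΦ0 _),
            ← ENNReal.ofReal_one, ← ENNReal.ofReal_add (integral_nonneg fun _ => hΦ0 _) zero_le_one]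
          exact ENNReal.ofReal_le_ofReal (by linarith)
  have hsum : ∀ n, ∫⁻ ω in notReached V b n, ENNReal.ofReal (Φ ((fun _ => b) - walk V n ω)) ∂P
      + ∑ k ∈ Finset.range n, P (notReached V b k) ≤ ENNReal.ofReal (Φ fun _ => b) := fun n => by
    induction n with
    | zero =>
      have h0 : ∀ ω, (fun _ => b) - walk V 0 ω = fun _ => b := fun ω => by ext; simp [walk]
      simp only [h0, Finset.range_zero, Finset.sum_empty, add_zero, lintegral_const]
      exact mul_le_of_le_one_right' (by simpa using prob_le_one)
    | succ n ih =>
      rw [Finset.sum_range_succ, add_comm (∑ k ∈ Finset.range n, _), ← add_assoc]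
      exact (add_le_add_left (hstep n) _).trans ih
  rw [lintegral_firstTime hmeas, ENNReal.tsum_eq_iSup_nat]
  exact iSup_le fun n => le_add_self.trans (hsum n)

/-! ### Lower bound: truncated Wald identity -/

lemma integral_sq_walk_sub (hindep : iIndepFun V P)
    (hident : ∀ t, IdentDistrib (V t) (V 0) P P) (j : Fin d)
    (hL : MemLp (fun ω => V 0 ω j) 2 P) (n : ℕ) :
    Integrable (fun ω => (walk V n ω j - n * drift P V j) ^ 2) P ∧
    ∫ ω, (walk V n ω j - n * drift P V j) ^ 2 ∂P = n * Var[fun ω => V 0 ω j; P] := by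
  have hid : ∀ t, IdentDistrib (fun ω => V t ω j) (fun ω => V 0 ω j) P P := fun t =>
    (hident t).comp (measurable_pi_apply j)
  have hLt : ∀ t, MemLp (fun ω => V t ω j) 2 P := fun t => (hid t).memLp_iff.2 hL
  have hfun : (fun ω => walk V n ω j) = ∑ t ∈ Finset.range n, fun ω => V t ω j := by
    ext ω
    simp [walk_apply]
  have hW : MemLp (fun ω => walk V n ω j) 2 P := by
    rw [hfun]
    exact memLp_finsetSum' _ fun t _ => hLt t
  have hmean : ∫ ω, walk V n ω j ∂P = n * drift P V j := by
    simp_rw [walk_apply]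
    rw [integral_finsetSum _ fun t _ => (hLt t).integrable (by norm_num)]
    simp_rw [(hid _).integral_eq]
    simp [drift]
  refine ⟨(hW.sub (memLp_const _)).integrable_sq, ?_⟩
  rw [← hmean, ← variance_eq_integral hW.aemeasurable, hfun,
    IndepFun.variance_sum (fun t _ => hLt t)]
  · simp_rw [(hid _).variance_eq]
    simp
  · intro s _ t _ hst
    exact (hindep.indepFun hst).comp (measurable_pi_apply j) (measurable_pi_apply j)

/-- The lower bound given by Wald's identity for the first coordinate. -/
lemma le_expectedTime [NeZero d] (hmeas : ∀ t, Measurable (V t))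
    (hindep : iIndepFun V P) (hident : ∀ t, IdentDistrib (V t) (V 0) P P)
    (hpos : 0 < drift P V 0) (hL : MemLp (fun ω => V 0 ω 0) 2 P) {b : ℝ}
    (hfin : expectedTime P V b ≠ ⊤) :
    b - Var[fun ω => V 0 ω 0; P] / (4 * drift P V 0)
      ≤ drift P V 0 * (expectedTime P V b).toReal := by
  rw [lintegral_firstTime hmeas] at hfin ⊢
  have hlim : Tendsto (fun n => P.real (notReached V b n)) atTop (nhds 0) := by
    have := (ENNReal.tendsto_toReal ENNReal.zero_ne_top).comp
      (ENNReal.tendsto_atTop_zero_of_tsum_ne_top hfin)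
    rwa [ENNReal.toReal_zero] at this
  have hid : ∀ t, IdentDistrib (fun ω => V t ω 0) (fun ω => V 0 ω 0) P P := fun t =>
    (hident t).comp (measurable_pi_apply 0)
  have hi : ∀ k, Integrable (fun ω => V k ω 0) P := fun k =>
    ((hid k).memLp_iff.2 hL).integrable (by norm_num)
  have hms := measurableSet_notReached hmeas b
  have hmean : ∀ k, ∫ ω, (notReached V b k).indicator (fun ω => V k ω 0) ω ∂P
      = drift P V 0 * P.real (notReached V b k) := fun k => by
    have h1 : ∀ ω, (notReached V b k).indicator (fun ω => V k ω 0) ω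
        = (notReached V b k).indicator 1 ω * V k ω 0 := fun ω => by
      by_cases h : ω ∈ notReached V b k <;> simp [h]
    simp_rw [h1]
    rw [(indepFun_indicator_notReached hmeas hindep b k 0).integral_fun_mul_eq_mul_integral
      (measurable_one.indicator (hms k)).aestronglyMeasurable (hi k).1, (hid k).integral_eq,
      integral_indicator_one (hms k), mul_comm]
    rfl
  have hbound : ∀ n : ℕ, b * (1 - P.real (notReached V b (n + 1)))
        - Var[fun ω => V 0 ω 0; P] / (4 * drift P V 0)
      ≤ drift P V 0 * (∑' k, P (notReached V b k)).toReal := fun n => by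
    obtain ⟨hq, hq'⟩ := integral_sq_walk_sub hindep hident 0 hL (n + 1)
    set N : ℝ := ((n + 1 : ℕ) : ℝ) with hN
    have hN0 : 0 < N := by positivity
    -- Before the level is reached `R_N` may be very negative. With `μ` the first drift, `R + (R - N
    -- μ)² / (4 N μ) = (R + N μ)² / (4 N μ) ≥ 0`, and this penalty has mean `Var / (4 μ)` for every
    -- `N`.
    have hpt : ∀ ω, b * (1 - (notReached V b (n + 1)).indicator 1 ω)
          - (walk V (n + 1) ω 0 - N * drift P V 0) ^ 2 / (4 * N * drift P V 0)
        ≤ ∑ k ∈ Finset.range (n + 1), (notReached V b k).indicator (fun ω => V k ω 0) ω := by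
      intro ω
      by_cases h : ω ∈ notReached V b (n + 1)
      · have hs : ∑ k ∈ Finset.range (n + 1), (notReached V b k).indicator (fun ω => V k ω 0) ω
            = walk V (n + 1) ω 0 := by
          rw [walk_apply]
          refine Finset.sum_congr rfl fun k hk => Set.indicator_of_mem
            (notReached_antitone V b (Finset.mem_range.1 hk).le h) _
        rw [hs, Set.indicator_of_mem h, Pi.one_apply, sub_self, mul_zero, zero_sub, neg_le,
          le_div_iff₀ (by positivity)]
        nlinarith [sq_nonneg (walk V (n + 1) ω 0 + N * drift P V 0)]
      · have h1 := le_sum_indicator_of_notMem h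
        have h2 : 0 ≤ (walk V (n + 1) ω 0 - N * drift P V 0) ^ 2 / (4 * N * drift P V 0) := by
          positivity
        rw [Set.indicator_of_notMem h, sub_zero, mul_one]
        linarith
    have hi1 : Integrable ((notReached V b (n + 1)).indicator (1 : Ω → ℝ)) P :=
      (integrable_const (1 : ℝ)).indicator (hms _)
    have hi2 : Integrable
        (fun ω => b * (1 - (notReached V b (n + 1)).indicator (1 : Ω → ℝ) ω)) P :=
      ((integrable_const _).sub hi1).const_mul b
    have hmono := integral_mono (hi2.sub (hq.div_const (4 * N * drift P V 0)))
      (integrable_finsetSum _ fun k _ => (hi k).indicator (hms k)) hpt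
    rw [integral_sub' hi2 (hq.div_const _), integral_const_mul,
      integral_sub (integrable_const _) hi1, integral_indicator_one (hms _), integral_div, hq',
      integral_finsetSum _ fun k _ => (hi k).indicator (hms k), integral_const, probReal_univ,
      one_smul] at hmono
    simp_rw [hmean] at hmono
    rw [← Finset.mul_sum] at hmono
    have h3 : ∑ k ∈ Finset.range (n + 1), P.real (notReached V b k)
        ≤ (∑' k, P (notReached V b k)).toReal := by
      simp only [measureReal_def]
      rw [← ENNReal.toReal_sum fun k _ => measure_ne_top _ _]
      exact ENNReal.toReal_mono hfin (ENNReal.sum_le_tsum _)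
    have h4 : N * Var[fun ω => V 0 ω 0; P] / (4 * N * drift P V 0)
        = Var[fun ω => V 0 ω 0; P] / (4 * drift P V 0) := by
      field_simp
    rw [h4] at hmono
    exact hmono.trans (mul_le_mul_of_nonneg_left h3 hpos.le)
  have hl := (((tendsto_const_nhds (x := (1 : ℝ))).sub
    (hlim.comp (tendsto_add_atTop_nat 1))).const_mul b).sub_const
      (Var[fun ω => V 0 ω 0; P] / (4 * drift P V 0))
  rw [sub_zero, mul_one] at hl
  exact le_of_tendsto hl (Eventually.of_forall hbound)

end Independence

/-! ### The Lyapunov function of the walk and the conclusion -/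

section Main

variable {Ω : Type*} [MeasurableSpace Ω] {P : Measure Ω} {d : ℕ}
  {V : ℕ → Ω → Fin d → ℝ}

lemma integrable_sq_mul_sqrt_abs {ξ : Ω → ℝ} (h : MemLp ξ (ENNReal.ofReal (5 / 2)) P) :
    Integrable (fun ω => ξ ω ^ 2 * √|ξ ω|) P := by
  have h1 := h.integrable_norm_rpow (by simp) (by simp)
  rw [ENNReal.toReal_ofReal (by norm_num)] at h1
  refine h1.congr (ae_of_all _ fun ω => ?_)
  change |ξ ω| ^ (5 / 2 : ℝ) = _
  rw [show (5 / 2 : ℝ) = (2 : ℕ) + 1 / 2 by norm_num,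
    Real.rpow_add_of_nonneg (abs_nonneg _) (by norm_num) (by norm_num), Real.rpow_natCast, sq_abs,
    ← Real.sqrt_eq_rpow]

variable [IsProbabilityMeasure P]

lemma memLp_two_of_memLp {ξ : Ω → ℝ} (h : MemLp ξ (ENNReal.ofReal (5 / 2)) P) : MemLp ξ 2 P := by
  refine h.mono_exponent ?_
  rw [← ENNReal.ofReal_ofNat]
  exact ENNReal.ofReal_le_ofReal (by norm_num)

lemma memLp_of_integrable_rpow {X : Ω → ℝ} (hX : Measurable X) {c q p : ℝ} (hp : 0 < p)
    (hpq : p ≤ q) (h : Integrable (fun ω => |X ω - c| ^ q) P) : MemLp X (ENNReal.ofReal p) P := by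
  have h1 : MemLp (fun ω => X ω - c) (ENNReal.ofReal p) P := by
    have hq : 0 < q := hp.trans_le hpq
    have hm : AEStronglyMeasurable (fun ω => X ω - c) P := by fun_prop
    refine MemLp.mono_exponent ?_ (ENNReal.ofReal_le_ofReal hpq)
    rw [← integrable_norm_rpow_iff hm (by simpa using hq) (by simp), ENNReal.toReal_ofReal hq.le]
    exact h
  refine (memLp_congr_ae (ae_of_all _ fun ω => ?_)).1 (h1.add (memLp_const c))
  simp

/-- A Lyapunov function for the walk, within a constant of `b / μ₁` on the diagonal. -/
lemma exists_lyapunov [NeZero d] (hL : ∀ j, MemLp (fun ω => V 0 ω j) (ENNReal.ofReal (5 / 2)) P)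
    (hpos : 0 < drift P V 0) (hasymm : ∀ j, j ≠ 0 → drift P V 0 < drift P V j) :
    ∃ Φ : (Fin d → ℝ) → ℝ, Measurable Φ ∧ (∀ y, 0 ≤ Φ y) ∧
      (∀ y, Integrable (fun ω => Φ (y - V 0 ω)) P) ∧
      (∀ y, (∃ j, 0 < y j) → ∫ ω, Φ (y - V 0 ω) ∂P ≤ Φ y - 1) ∧
      ∃ C, ∀ b, 0 ≤ b → Φ (fun _ => b) ≤ b / drift P V 0 + C := by
  have hint : ∀ j, Integrable (fun ω => V 0 ω j) P := fun j =>
    (memLp_two_of_memLp (hL j)).integrable (by norm_num)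
  obtain ⟨φ, hφm, hφ0, hφi, ⟨B, hB0, hB⟩, hφd, C, hC⟩ := exists_lyapunov_le_div_add
    (ξ := fun ω => -V 0 ω 0) (hint 0).neg (integrable_sq_mul_sqrt_abs (hL 0).neg)
    (integral_neg _) hpos
  have hψ : ∀ j : {j : Fin d // j ≠ 0}, ∃ ψ : ℝ → ℝ, Measurable ψ ∧ (∀ z, 0 ≤ ψ z) ∧
      (∀ z, Integrable (fun ω => ψ (z + (V 0 ω 0 - V 0 ω j))) P) ∧
      (∀ z, ∫ ω, ψ (z + (V 0 ω 0 - V 0 ω j)) ∂P ≤ ψ z) ∧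
      ∀ z, 0 ≤ z → ∫ ω, ψ (z + (V 0 ω 0 - V 0 ω j)) ∂P ≤ ψ z - (B + 1) := fun j => by
    have hj := (hL 0).sub (hL j)
    refine exists_lyapunov_of_neg_drift ((hint 0).sub (hint j))
      (memLp_two_of_memLp hj).integrable_sq (integrable_sq_mul_sqrt_abs hj) ?_ (by positivity)
    rw [integral_sub' (hint 0) (hint j)]
    exact sub_neg.2 (hasymm j j.2)
  choose ψ hψm hψ0 hψi hψd hψD using hψ
  have hstep : ∀ y, (fun ω => φ ((y - V 0 ω) 0) + ∑ j, ψ j ((y - V 0 ω) j - (y - V 0 ω) 0))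
      = fun ω => φ (y 0 + -V 0 ω 0) + ∑ j, ψ j (y j - y 0 + (V 0 ω 0 - V 0 ω j)) := fun y => by
    ext ω
    simp only [Pi.sub_apply]
    congr 1
    exact Finset.sum_congr rfl fun j _ => by congr 1; ring
  have hsi : ∀ y : Fin d → ℝ,
      Integrable (fun ω => ∑ j, ψ j (y j - y 0 + (V 0 ω 0 - V 0 ω j))) P := fun y =>
    integrable_finsetSum _ fun j _ => hψi j _
  refine ⟨fun y => φ (y 0) + ∑ j, ψ j (y j - y 0), by fun_prop,
    fun y => add_nonneg (hφ0 _) (Finset.sum_nonneg fun j _ => hψ0 j _), fun y => ?_, ?_,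
    C + ∑ j, ψ j 0, fun b hb => ?_⟩
  · rw [hstep]
    exact (hφi _).add (hsi y)
  · rintro y ⟨i, hi⟩
    rw [hstep, integral_add (hφi _) (hsi y), integral_finsetSum _ fun j _ => hψi j _]
    have hle : ∑ j, ∫ ω, ψ j (y j - y 0 + (V 0 ω 0 - V 0 ω j)) ∂P ≤ ∑ j, ψ j (y j - y 0) :=
      Finset.sum_le_sum fun j _ => hψd j _
    -- If `y 0 ≥ 0`, then `φ` loses `1`. Otherwise `y i - y 0 > 0`, and the loss `B + 1` of `ψ i`
    -- outweighs the gain `B` of `φ`.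
    rcases le_or_gt 0 (y 0) with h0 | h0
    · linarith [hφd _ h0]
    · have hi0 : i ≠ 0 := by
        rintro rfl
        exact lt_asymm hi h0
      have hlt : ∑ j, ∫ ω, ψ j (y j - y 0 + (V 0 ω 0 - V 0 ω j)) ∂P
          ≤ ∑ j, ψ j (y j - y 0) - (B + 1) := by
        rw [← Finset.add_sum_erase _ _ (Finset.mem_univ (⟨i, hi0⟩ : {j : Fin d // j ≠ 0})),
          ← Finset.add_sum_erase _ _ (Finset.mem_univ (⟨i, hi0⟩ : {j : Fin d // j ≠ 0})),
          add_sub_right_comm]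
        exact add_le_add (hψD ⟨i, hi0⟩ _ (by linarith)) (Finset.sum_le_sum fun j _ => hψd j _)
      linarith [hB (y 0)]
  · simp only [sub_self]
    have h1 : φ b ≤ b / drift P V 0 + C := hC b hb
    linarith

end Main

end MultiRW

theorem mainTheorem4 {Ω : Type*} [MeasurableSpace Ω] (P : Measure Ω) [IsProbabilityMeasure P]
    (d : ℕ) [NeZero d] (V : ℕ → Ω → Fin d → ℝ)
    (hmeas : ∀ t, Measurable (V t))
    (hindep : iIndepFun V P)
    (hident : ∀ t, IdentDistrib (V t) (V 0) P P)
    (hpos : 0 < MultiRW.drift P V 0)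
    (hasymm : ∀ j, j ≠ 0 → MultiRW.drift P V 0 < MultiRW.drift P V j)
    (q : ℝ) (hq : 2 * Real.sqrt 2 < q)
    (hmoment : ∀ j, Integrable (fun ω => |V 0 ω j - MultiRW.drift P V j| ^ q) P) :
    (∀ b : ℝ, MultiRW.expectedTime P V b ≠ ⊤) ∧
      (fun b : ℝ => (MultiRW.expectedTime P V b).toReal - b / MultiRW.drift P V 0)
        =O[atTop] (fun _ => (1 : ℝ)) := by
  have hq' : 5 / 2 ≤ q := by
    have : (5 / 4 : ℝ) ≤ √2 := Real.le_sqrt_of_sq_le (by norm_num)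
    linarith
  have hL : ∀ j, MemLp (fun ω => V 0 ω j) (ENNReal.ofReal (5 / 2)) P := fun j =>
    MultiRW.memLp_of_integrable_rpow ((measurable_pi_apply j).comp (hmeas 0)) (by norm_num) hq'
      (hmoment j)
  obtain ⟨Φ, hΦm, hΦ0, hΦi, hΦd, C, hC⟩ := MultiRW.exists_lyapunov hL hpos hasymm
  have hupper : ∀ b, 0 < b → MultiRW.expectedTime P V b ≤ ENNReal.ofReal (Φ fun _ => b) :=
    fun b hb => MultiRW.expectedTime_le_of_drift hmeas hindep hident hΦm hΦ0 hΦi hΦd hb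
  have hfin : ∀ b, MultiRW.expectedTime P V b ≠ ⊤ := fun b => by
    refine ne_top_of_le_ne_top ENNReal.ofReal_ne_top
      -- The drift bound needs a positive level; smaller `b` follow by monotonicity of `T_b` in `b`.
      (le_trans ?_ (hupper (max b 1) (by positivity)))
    exact lintegral_mono fun ω => ENat.toENNReal_mono (MultiRW.firstTime_mono V (le_max_left _ _) ω)
  refine ⟨hfin, IsBigO.of_bound
    (max C (Var[fun ω => V 0 ω 0; P] / (4 * MultiRW.drift P V 0) / MultiRW.drift P V 0)) ?_⟩
  filter_upwards [eventually_gt_atTop 0] with b hb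
  rw [norm_one, mul_one, Real.norm_eq_abs, abs_le]
  constructor
  · have h1 := MultiRW.le_expectedTime hmeas hindep hident hpos
      (MultiRW.memLp_two_of_memLp (hL 0)) (hfin b)
    rw [← div_le_iff₀' hpos, sub_div] at h1
    linarith [le_max_right C
      (Var[fun ω => V 0 ω 0; P] / (4 * MultiRW.drift P V 0) / MultiRW.drift P V 0)]
  · have h1 := ENNReal.toReal_mono ENNReal.ofReal_ne_top (hupper b hb)
    rw [ENNReal.toReal_ofReal (hΦ0 _)] at h1
    linarith [hC b hb.le, le_max_left C
      (Var[fun ω => V 0 ω 0; P] / (4 * MultiRW.drift P V 0) / MultiRW.drift P V 0)]
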